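/- A WHB-algebra (weak Heyting Brouwer algebra) is an algebra $(A,\wedge,\vee,\to,\leftarrow,0,1)$ such that $(A,\wedge,\vee,0,1)$ is a bounded distributive lattice and, for all $a,b,c\in A$, $$a\to a=1,\quad a\to(b\wedge c)=(a\to b)\wedge(a\to c),\quad (a\vee b)\to c=(a\to c)\wedge(b\to c),\quad (a\to b)\wedge(b\to c)\le a\to c,$$ $$a\leftarrow a=0,\quad (a\vee b)\leftarrow c=(a\leftarrow c)\vee(b\leftarrow c),\quad a\leftarrow(b\wedge c)=(a\leftarrow b)\vee(a\leftarrow c),\quad a\leftarrow c\le(a\leftarrow b)\vee(b\leftarrow c),$$ $$a\wedge((a\to b)\leftarrow 0)\le b,\qquad a\le b\vee(1\to(a\leftarrow b)).$$ A tense algebra is a Boolean algebra with unary operators $G,H$ such that, for $P(x)=\neg H(\neg x)$ and $F(x)=\neg G(\neg x)$, one has $P(x)\le y\Leftrightarrow x\le G(y)$ and $F(x)\le y\Leftrightarrow x\le H(y)$. Let $\mathcal{WHB}$ and $\mathcal{TBA}$ be the varieties of all WHB-algebras and of all tense algebras. For a tense algebra $\mathbf B$, let $M(\mathbf B)$ be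 the WHB-algebra on the lattice reduct of $\mathbf B$ with $x\to y=G(\neg x\vee y)$ and $x\leftarrow y=P(x\wedge\neg y)$. For a WHB-algebra $\mathbf A$, let $X(\mathbf A)$ be the set of its prime filters, $\sigma(a)=\{Q\in X(\mathbf A): a\in Q\}$, and for $Q,Q'\in X(\mathbf A)$ put $$(Q,Q')\in R\iff \forall a,b\ (a\to b\in Q,\ a\in Q'\Rightarrow b\in Q'),\qquad (Q,Q')\in S\iff\forall a,b\ (a\in Q',\ b\notin Q'\Rightarrow a\leftarrow b\in Q).$$ The free tense extension $T(\mathbf A)$ is the tense algebra whose underlying Boolean algebra consists of the finite unions of sets $\sigma(a)\setminus\sigma(b)$, $a,b\in A$, with $G(U)=\{Q: R(Q)\subseteq U\}$ and $H(U)=\{Q: S(Q)\subseteq U\}$. A variety $\mathcal N$ of tense algebras is a tense companion of a variety $\mathcal K$ of WHB-algebras if $T(\mathbf A)\in\mathcal N$ for all $\mathbf A\in\mathcal K$ and $M(\mathbf B)\in\mathcal K$ for all $\mathbf B\in\mathcal N$. A class $\mathcal V$ of algebras has the congruence extension property (CEP) if for every $\mathbf B\in\mathcal V$, every subalgebra $\mathbf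 A$ of $\mathbf B$ and every congruence $\delta$ of $\mathbf A$ there is a congruence $\theta$ of $\mathbf B$ with $\delta=\theta\cap A^2$. Theorem. (1) If $\mathcal K$ is a variety of WHB-algebras and $\mathcal N$ is a tense companion of $\mathcal K$, then $\mathcal K$ has the CEP if and only if $\mathcal N$ has the CEP. (2) The variety $\mathcal{TBA}$ has the CEP. (3) The variety $\mathcal{WHB}$, and every subvariety of it, has the CEP. -/

import Mathlib

universe u

/-! ### Weak Heyting Brouwer algebras and tense algebras -/

/-- A weak Heyting Brouwer algebra: a bounded distributive lattice with a strict implication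
`imp a b` (`a → b`) and a weak difference `diff a b` (`a ← b`), such that `imp` satisfies the
axioms of weak Heyting algebras, `diff` those of weak difference algebras, and the two linking
conditions E1 and E2 hold. -/
class WHBAlgebra (α : Type u) extends DistribLattice α, BoundedOrder α where
  /-- strict implication `a → b` -/
  imp : α → α → α
  /-- weak difference `a ← b` -/
  diff : α → α → α
  imp_self : ∀ a, imp a a = ⊤
  imp_inf : ∀ a b c, imp a (b ⊓ c) = imp a b ⊓ imp a c
  sup_imp : ∀ a b c, imp (a ⊔ b) c = imp a c ⊓ imp b c
  imp_trans : ∀ a b c, imp a b ⊓ imp b c ≤ imp a c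
  diff_self : ∀ a, diff a a = ⊥
  sup_diff : ∀ a b c, diff (a ⊔ b) c = diff a c ⊔ diff b c
  diff_inf : ∀ a b c, diff a (b ⊓ c) = diff a b ⊔ diff a c
  diff_trans : ∀ a b c, diff a c ≤ diff a b ⊔ diff b c
  /-- condition E1 -/
  inf_diff_imp_le : ∀ a b, a ⊓ diff (imp a b) ⊥ ≤ b
  /-- condition E2 -/
  le_sup_imp_diff : ∀ a b, a ≤ b ⊔ imp ⊤ (diff a b)

/-- A tense (Boolean) algebra: a Boolean algebra with unary operators `G`, `H` such that
`P ⊣ G` and `F ⊣ H`, where `P x = ¬ H (¬ x)` and `F x = ¬ G (¬ x)`. -/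
class TenseAlgebra (α : Type u) extends BooleanAlgebra α where
  G : α → α
  H : α → α
  gc_P_G : GaloisConnection (fun x : α => (H xᶜ)ᶜ) G
  gc_F_H : GaloisConnection (fun x : α => (G xᶜ)ᶜ) H

/-- The bundled WHB-algebras; the type of all of them is the variety of WHB-algebras. -/
structure WHBAlg : Type (u + 1) where
  carrier : Type u
  [str : WHBAlgebra carrier]

instance : CoeSort WHBAlg.{u} (Type u) := ⟨WHBAlg.carrier⟩
instance (A : WHBAlg.{u}) : WHBAlgebra A := A.str

/-- The bundled tense algebras. -/
structure TenseAlg : Type (u + 1) where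
  carrier : Type u
  [str : TenseAlgebra carrier]

instance : CoeSort TenseAlg.{u} (Type u) := ⟨TenseAlg.carrier⟩
instance (B : TenseAlg.{u}) : TenseAlgebra B := B.str

/-! ### Varieties as equational classes -/

/-- Terms in the language of WHB-algebras over countably many variables. -/
inductive WHBTerm : Type
  | var : ℕ → WHBTerm
  | bot : WHBTerm
  | top : WHBTerm
  | inf : WHBTerm → WHBTerm → WHBTerm
  | sup : WHBTerm → WHBTerm → WHBTerm
  | imp : WHBTerm → WHBTerm → WHBTerm
  | diff : WHBTerm → WHBTerm → WHBTerm

/-- The value of a term under an assignment `v` of the variables. -/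
def WHBTerm.eval {α : Type u} [WHBAlgebra α] (v : ℕ → α) : WHBTerm → α
  | .var n => v n
  | .bot => ⊥
  | .top => ⊤
  | .inf s t => s.eval v ⊓ t.eval v
  | .sup s t => s.eval v ⊔ t.eval v
  | .imp s t => WHBAlgebra.imp (s.eval v) (t.eval v)
  | .diff s t => WHBAlgebra.diff (s.eval v) (t.eval v)

/-- A class of WHB-algebras is a variety if it is the class of all WHB-algebras that satisfy
some set of equations. -/
def IsWHBVariety (K : Set WHBAlg.{u}) : Prop :=
  ∃ E : Set (WHBTerm × WHBTerm),
    K = {A : WHBAlg.{u} | ∀ e ∈ E, ∀ v : ℕ → A, e.1.eval v = e.2.eval v}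

/-- Terms in the language of tense algebras over countably many variables. -/
inductive TenseTerm : Type
  | var : ℕ → TenseTerm
  | bot : TenseTerm
  | top : TenseTerm
  | inf : TenseTerm → TenseTerm → TenseTerm
  | sup : TenseTerm → TenseTerm → TenseTerm
  | compl : TenseTerm → TenseTerm
  | G : TenseTerm → TenseTerm
  | H : TenseTerm → TenseTerm

/-- The value of a term under an assignment `v` of the variables. -/
def TenseTerm.eval {α : Type u} [TenseAlgebra α] (v : ℕ → α) : TenseTerm → α
  | .var n => v n
  | .bot => ⊥
  | .top => ⊤
  | .inf s t => s.eval v ⊓ t.eval v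
  | .sup s t => s.eval v ⊔ t.eval v
  | .compl s => (s.eval v)ᶜ
  | .G s => TenseAlgebra.G (s.eval v)
  | .H s => TenseAlgebra.H (s.eval v)

/-- A class of tense algebras is a variety if it is the class of all tense algebras that satisfy
some set of equations. -/
def IsTenseVariety (N : Set TenseAlg.{u}) : Prop :=
  ∃ E : Set (TenseTerm × TenseTerm),
    N = {B : TenseAlg.{u} | ∀ e ∈ E, ∀ v : ℕ → B, e.1.eval v = e.2.eval v}

/-! ### Subalgebras, congruences and the congruence extension property -/

/-- A subalgebra of a WHB-algebra. -/
structure WHBSubalgebra (α : Type u) [WHBAlgebra α] extends Sublattice α where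
  bot_mem : ⊥ ∈ carrier
  top_mem : ⊤ ∈ carrier
  imp_mem : ∀ {a b}, a ∈ carrier → b ∈ carrier → WHBAlgebra.imp a b ∈ carrier
  diff_mem : ∀ {a b}, a ∈ carrier → b ∈ carrier → WHBAlgebra.diff a b ∈ carrier

instance {α : Type u} [WHBAlgebra α] : CoeSort (WHBSubalgebra α) (Type u) :=
  ⟨fun S => S.toSublattice⟩

/-- A subalgebra of a WHB-algebra, with the restricted operations, is a WHB-algebra. -/
instance {α : Type u} [WHBAlgebra α] (S : WHBSubalgebra α) : WHBAlgebra S where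
  top := ⟨⊤, S.top_mem⟩
  bot := ⟨⊥, S.bot_mem⟩
  le_top a := (le_top : (a : α) ≤ ⊤)
  bot_le a := (bot_le : ⊥ ≤ (a : α))
  imp a b := ⟨WHBAlgebra.imp a b, S.imp_mem a.2 b.2⟩
  diff a b := ⟨WHBAlgebra.diff a b, S.diff_mem a.2 b.2⟩
  imp_self a := Subtype.ext (WHBAlgebra.imp_self (a : α))
  imp_inf a b c := Subtype.ext (WHBAlgebra.imp_inf (a : α) b c)
  sup_imp a b c := Subtype.ext (WHBAlgebra.sup_imp (a : α) b c)
  imp_trans a b c := WHBAlgebra.imp_trans (a : α) b c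
  diff_self a := Subtype.ext (WHBAlgebra.diff_self (a : α))
  sup_diff a b c := Subtype.ext (WHBAlgebra.sup_diff (a : α) b c)
  diff_inf a b c := Subtype.ext (WHBAlgebra.diff_inf (a : α) b c)
  diff_trans a b c := WHBAlgebra.diff_trans (a : α) b c
  inf_diff_imp_le a b := WHBAlgebra.inf_diff_imp_le (a : α) b
  le_sup_imp_diff a b := WHBAlgebra.le_sup_imp_diff (a : α) b

/-- A congruence of a WHB-algebra: an equivalence relation compatible with all operations. -/
structure WHBCongruence (α : Type u) [WHBAlgebra α] extends LatticeCon α where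
  imp : ∀ {a b c d}, r a b → r c d → r (WHBAlgebra.imp a c) (WHBAlgebra.imp b d)
  diff : ∀ {a b c d}, r a b → r c d → r (WHBAlgebra.diff a c) (WHBAlgebra.diff b d)

/-- The congruence extension property of a class of WHB-algebras: for every subalgebra `A` of a
member `B`, each congruence `δ` of `A` is the restriction to `A` of a congruence `θ` of `B`. -/
def WHBHasCEP (K : Set WHBAlg.{u}) : Prop :=
  ∀ B ∈ K, ∀ (A : WHBSubalgebra B) (δ : WHBCongruence A),
    ∃ θ : WHBCongruence B, ∀ a b : A, δ.r a b ↔ θ.r (a : B) (b : B)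

/-- A subalgebra of a tense algebra. -/
structure TenseSubalgebra (α : Type u) [TenseAlgebra α] extends BooleanSubalgebra α where
  G_mem : ∀ {a}, a ∈ carrier → TenseAlgebra.G a ∈ carrier
  H_mem : ∀ {a}, a ∈ carrier → TenseAlgebra.H a ∈ carrier

instance {α : Type u} [TenseAlgebra α] : CoeSort (TenseSubalgebra α) (Type u) :=
  ⟨fun S => S.toBooleanSubalgebra⟩

/-- A subalgebra of a tense algebra, with the restricted operations, is a tense algebra. -/
instance {α : Type u} [TenseAlgebra α] (S : TenseSubalgebra α) : TenseAlgebra S where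
  G a := ⟨TenseAlgebra.G (a : α), S.G_mem a.2⟩
  H a := ⟨TenseAlgebra.H (a : α), S.H_mem a.2⟩
  gc_P_G a b := TenseAlgebra.gc_P_G (a : α) b
  gc_F_H a b := TenseAlgebra.gc_F_H (a : α) b

/-- A congruence of a tense algebra: an equivalence relation compatible with all operations. -/
structure TenseCongruence (α : Type u) [TenseAlgebra α] extends LatticeCon α where
  compl : ∀ {a b}, r a b → r aᶜ bᶜ
  G : ∀ {a b}, r a b → r (TenseAlgebra.G a) (TenseAlgebra.G b)
  H : ∀ {a b}, r a b → r (TenseAlgebra.H a) (TenseAlgebra.H b)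

/-- The congruence extension property of a class of tense algebras. -/
def TenseHasCEP (N : Set TenseAlg.{u}) : Prop :=
  ∀ B ∈ N, ∀ (A : TenseSubalgebra B) (δ : TenseCongruence A),
    ∃ θ : TenseCongruence B, ∀ a b : A, δ.r a b ↔ θ.r (a : B) (b : B)

/-! ### The WHB-algebra of a tense algebra -/

theorem TenseAlgebra.G_inf {β : Type u} [TenseAlgebra β] (x y : β) : G (x ⊓ y) = G x ⊓ G y := gc_P_G.u_inf

theorem TenseAlgebra.P_sup {β : Type u} [TenseAlgebra β] (x y : β) :
    (H (x ⊔ y)ᶜ)ᶜ = (H xᶜ)ᶜ ⊔ (H yᶜ)ᶜ := gc_P_G.l_sup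

/-- A tense algebra regarded as a WHB-algebra: `a → b = G (¬ a ∨ b)` and
`a ← b = P (a ∧ ¬ b)`, where `P x = ¬ H (¬ x)`. -/
abbrev TenseAlgebra.toWHBAlgebra (β : Type u) [TenseAlgebra β] : WHBAlgebra β where
  imp a b := TenseAlgebra.G (aᶜ ⊔ b)
  diff a b := (TenseAlgebra.H (a ⊓ bᶜ)ᶜ)ᶜ
  imp_self a := by simpa using TenseAlgebra.gc_P_G.u_top
  imp_inf a b c := by rw [sup_inf_left, TenseAlgebra.G_inf]
  sup_imp a b c := by rw [compl_sup, sup_inf_right, TenseAlgebra.G_inf]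
  imp_trans a b c := by
    rw [← TenseAlgebra.G_inf]
    apply TenseAlgebra.gc_P_G.monotone_u
    rw [inf_sup_right, inf_sup_left b, inf_compl_self, bot_sup_eq]
    exact sup_le (inf_le_left.trans le_sup_left) (inf_le_right.trans le_sup_right)
  diff_self a := by
    rw [inf_compl_self]
    exact TenseAlgebra.gc_P_G.l_bot
  sup_diff a b c := by rw [inf_sup_right, TenseAlgebra.P_sup]
  diff_inf a b c := by rw [compl_inf (x := b) (y := c), inf_sup_left, TenseAlgebra.P_sup]
  diff_trans a b c := by
    rw [← TenseAlgebra.P_sup]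
    apply TenseAlgebra.gc_P_G.monotone_l
    calc a ⊓ cᶜ = (a ⊓ cᶜ) ⊓ (b ⊔ bᶜ) := by rw [sup_compl_eq_top, inf_top_eq]
      _ = (a ⊓ cᶜ) ⊓ b ⊔ (a ⊓ cᶜ) ⊓ bᶜ := inf_sup_left _ _ _
      _ ≤ a ⊓ bᶜ ⊔ b ⊓ cᶜ := sup_le
        (le_sup_of_le_right (le_inf inf_le_right (inf_le_left.trans inf_le_right)))
        (le_sup_of_le_left (le_inf (inf_le_left.trans inf_le_left) inf_le_right))
  inf_diff_imp_le a b := by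
    have h := TenseAlgebra.gc_P_G.l_u_le (aᶜ ⊔ b)
    simp only [compl_bot, inf_top_eq]
    refine (inf_le_inf_left a h).trans ?_
    rw [inf_sup_left, inf_compl_self, bot_sup_eq]
    exact inf_le_right
  le_sup_imp_diff a b := by
    have h := TenseAlgebra.gc_P_G.le_u_l (a ⊓ bᶜ)
    simp only [compl_top, bot_sup_eq]
    refine le_trans ?_ (sup_le_sup_left h b)
    rw [sup_inf_left, sup_compl_eq_top, inf_top_eq]
    exact le_sup_right

/-- `M(B)`, the tense algebra `B` regarded as a WHB-algebra. -/
def TenseAlg.M (B : TenseAlg.{u}) : WHBAlg.{u} where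
  carrier := B
  str := TenseAlgebra.toWHBAlgebra B

/-! ### The free tense extension of a WHB-algebra -/

/-- The set `X(A)` of prime filters of `A`. -/
def PrimeFilter (α : Type u) [Preorder α] : Type u := {P : Order.PFilter α // P.IsPrime}

instance {α : Type u} [Preorder α] : Membership α (PrimeFilter α) := ⟨fun P a => a ∈ P.1⟩

namespace PrimeFilter

theorem mem_of_le {α : Type u} [DistribLattice α] (P : PrimeFilter α)
    {a b : α} (h : a ≤ b) (ha : a ∈ P) : b ∈ P := P.1.mem_of_le h ha

theorem inf_mem_iff {α : Type u} [DistribLattice α] (P : PrimeFilter α) {a b : α} :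
    a ⊓ b ∈ P ↔ a ∈ P ∧ b ∈ P := Order.PFilter.inf_mem_iff

section Lattice

variable {α : Type u} [DistribLattice α] [BoundedOrder α] (P : PrimeFilter α)

theorem top_mem : ⊤ ∈ P := P.1.top_mem

theorem bot_notMem : ⊥ ∉ P := by
  obtain ⟨a, ha⟩ := P.2.compl_ideal.Nonempty
  exact fun h => ha (P.1.mem_of_le bot_le h)

theorem sup_mem_iff {α : Type u} [DistribLattice α] (P : PrimeFilter α) {a b : α} :
    a ⊔ b ∈ P ↔ a ∈ P ∨ b ∈ P := by
  refine ⟨fun h => ?_, fun h => h.elim (P.mem_of_le le_sup_left) (P.mem_of_le le_sup_right)⟩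
  by_contra! hn
  obtain ⟨c, hc, hac, hbc⟩ := P.2.compl_ideal.Directed a hn.1 b hn.2
  exact hc (P.1.mem_of_le (sup_le hac hbc) h)

/-- The Stone map `a ↦ {P | a ∈ P}`. -/
def stone (a : α) : Set (PrimeFilter α) := {P | a ∈ P}

theorem stone_bot : stone (⊥ : α) = ∅ := Set.eq_empty_of_forall_notMem fun P => P.bot_notMem

theorem stone_top : stone (⊤ : α) = Set.univ := Set.eq_univ_of_forall fun P => P.top_mem

theorem isSublattice_range_stone : IsSublattice (Set.range (stone (α := α))) where
  supClosed := by
    rintro _ ⟨a, rfl⟩ _ ⟨b, rfl⟩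
    exact ⟨a ⊔ b, Set.ext fun P => P.sup_mem_iff⟩
  infClosed := by
    rintro _ ⟨a, rfl⟩ _ ⟨b, rfl⟩
    exact ⟨a ⊓ b, Set.ext fun P => P.inf_mem_iff⟩

theorem finite_unions_eq_closure :
    {U : Set (PrimeFilter α) | ∃ t : Finset (α × α), U = ⋃ p ∈ t, stone p.1 \ stone p.2} =
      BooleanSubalgebra.closure (Set.range (stone (α := α))) := by
  classical
  ext U
  rw [SetLike.mem_coe, BooleanSubalgebra.mem_closure_iff_sup_sdiff isSublattice_range_stone
    ⟨⊥, stone_bot⟩ ⟨⊤, stone_top⟩]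
  constructor
  · rintro ⟨t, rfl⟩
    refine ⟨t.image fun p => (⟨stone p.1, p.1, rfl⟩, ⟨stone p.2, p.2, rfl⟩), ?_⟩
    rw [Finset.sup_image, Finset.sup_eq_iSup]
    rfl
  · rintro ⟨t, rfl⟩
    refine ⟨t.image fun x => (x.1.2.choose, x.2.2.choose), ?_⟩
    rw [Finset.set_biUnion_finset_image, Finset.sup_eq_iSup]
    refine iSup_congr fun x => iSup_congr fun _ => ?_
    rw [x.1.2.choose_spec, x.2.2.choose_spec]

variable (α) in
/-- The free Boolean extension of `A`: the Boolean algebra of the sets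
`⋃ i ≤ n, σ(a i) \ σ(b i)` of prime filters. -/
def freeBooleanExtension : BooleanSubalgebra (Set (PrimeFilter α)) :=
  (BooleanSubalgebra.closure (Set.range stone)).copy
    {U | ∃ t : Finset (α × α), U = ⋃ p ∈ t, stone p.1 \ stone p.2} finite_unions_eq_closure

theorem mem_freeBooleanExtension {U : Set (PrimeFilter α)} : U ∈ freeBooleanExtension α ↔
    ∃ t : Finset (α × α), U = ⋃ p ∈ t, stone p.1 \ stone p.2 := Iff.rfl

theorem stone_mem (a : α) : stone a ∈ freeBooleanExtension α :=
  ⟨{(a, ⊥)}, by simp [stone_bot]⟩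

theorem exists_of_rel {α : Type u} [DistribLattice α] {rel : α → α → Prop} (of_le : ∀ {x y}, x ≤ y → rel x y)
    (trans : ∀ {x y z}, rel x y → rel y z → rel x z)
    (inf : ∀ {x y z}, rel x y → rel x z → rel x (y ⊓ z))
    (sup : ∀ {x y z}, rel x z → rel y z → rel (x ⊔ y) z) {a b : α} (hab : ¬ rel a b) :
    ∃ Q : PrimeFilter α, a ∈ Q ∧ b ∉ Q ∧ ∀ x y, rel x y → x ∈ Q → y ∈ Q := by
  let T : Set (Set α) := {F | a ∈ F ∧ b ∉ F ∧ (∀ x y, rel x y → x ∈ F → y ∈ F) ∧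
    ∀ x y, x ∈ F → y ∈ F → x ⊓ y ∈ F}
  obtain ⟨M, -, hM⟩ := zorn_subset_nonempty T (by
    rintro c hc hch ⟨F₀, hF₀⟩
    refine ⟨⋃₀ c, ⟨⟨F₀, hF₀, (hc hF₀).1⟩, ?_, ?_, ?_⟩, fun s hs => Set.subset_sUnion_of_mem hs⟩
    · rintro ⟨F, hF, h⟩
      exact (hc hF).2.1 h
    · rintro x y hxy ⟨F, hF, h⟩
      exact ⟨F, hF, (hc hF).2.2.1 x y hxy h⟩
    · rintro x y ⟨F, hF, h⟩ ⟨F', hF', h'⟩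
      rcases hch.total hF hF' with hl | hl
      · exact ⟨F', hF', (hc hF').2.2.2 x y (hl h) h'⟩
      · exact ⟨F, hF, (hc hF).2.2.2 x y h (hl h')⟩)
    {y | rel a y}
    ⟨of_le le_rfl, hab, fun x y hxy hx => trans hx hxy, fun x y hx hy => inf hx hy⟩
  obtain ⟨haM, hbM, hrel, hinf⟩ := hM.prop
  have key : ∀ c, c ∉ M → ∃ m ∈ M, rel (m ⊓ c) b := by
    intro c hc
    by_contra! hcon
    have hsub := hM.le_of_ge (y := {y | ∃ m ∈ M, rel (m ⊓ c) y})
      ⟨⟨a, haM, of_le inf_le_left⟩, fun ⟨m, hm, h⟩ => hcon m hm h,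
        fun x y hxy ⟨m, hm, h⟩ => ⟨m, hm, trans h hxy⟩, by
        rintro x y ⟨m, hm, h⟩ ⟨m', hm', h'⟩
        exact ⟨m ⊓ m', hinf m m' hm hm', inf
          (trans (of_le (inf_le_inf_right c inf_le_left)) h)
          (trans (of_le (inf_le_inf_right c inf_le_right)) h')⟩⟩
      (fun x hx => ⟨x, hx, of_le inf_le_left⟩)
    exact hc (hsub ⟨a, haM, of_le inf_le_right⟩)
  have hfil : Order.IsPFilter M := .of_def ⟨a, haM⟩
    (fun x hx y hy => ⟨x ⊓ y, hinf x y hx hy, inf_le_left, inf_le_right⟩)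
    (fun h hx => hrel _ _ (of_le h) hx)
  refine ⟨⟨hfil.toPFilter, ⟨⟨?_, ⟨b, hbM⟩, ?_⟩⟩⟩, haM, hbM, hrel⟩
  · exact fun x y hyx hx hy => hx (hrel _ _ (of_le hyx) hy)
  · refine fun x hx y hy => ⟨x ⊔ y, fun hxy => ?_, le_sup_left, le_sup_right⟩
    obtain ⟨m, hm, h⟩ := key x hx
    obtain ⟨m', hm', h'⟩ := key y hy
    refine hbM (hrel _ _ ?_ (hinf _ _ (hinf _ _ hm hm') hxy))
    rw [inf_sup_left]
    exact sup (trans (of_le (inf_le_inf_right x inf_le_left)) h)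
      (trans (of_le (inf_le_inf_right y inf_le_right)) h')

end Lattice

section WHB

variable {α : Type u} [WHBAlgebra α]

open WHBAlgebra

/-- The relation `R` on prime filters. -/
def R (P Q : PrimeFilter α) : Prop := ∀ a b : α, imp a b ∈ P → a ∈ Q → b ∈ Q

/-- The relation `S` on prime filters. -/
def S (P Q : PrimeFilter α) : Prop := ∀ a b : α, a ∈ Q → b ∉ Q → diff a b ∈ P

theorem S_iff_R {P Q : PrimeFilter α} : S P Q ↔ R Q P := by
  constructor
  · intro h a b hab ha
    exact P.mem_of_le (inf_diff_imp_le a b) (P.inf_mem_iff.2 ⟨ha, h _ _ hab Q.bot_notMem⟩)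
  · intro h a b ha hb
    have := Q.sup_mem_iff.1 (Q.mem_of_le (le_sup_imp_diff a b) ha)
    exact h _ _ (this.resolve_left hb) P.top_mem

theorem imp_mem_iff {P : PrimeFilter α} {a b : α} :
    imp a b ∈ P ↔ ∀ Q, R P Q → a ∈ Q → b ∈ Q := by
  refine ⟨fun h Q hQ => hQ a b h, fun h => ?_⟩
  by_contra hab
  have of_le : ∀ {x y : α}, x ≤ y → imp x y ∈ P := fun {x y} hxy => by
    have h1 := imp_inf x x y
    rw [inf_eq_left.2 hxy, WHBAlgebra.imp_self, top_inf_eq] at h1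
    exact h1 ▸ P.top_mem
  obtain ⟨Q, ha, hb, hQ⟩ := exists_of_rel (rel := fun x y => imp x y ∈ P) of_le
    (fun {x y z} h1 h2 => P.mem_of_le (imp_trans x y z) (P.inf_mem_iff.2 ⟨h1, h2⟩))
    (fun {x y z} h1 h2 => imp_inf x y z ▸ P.inf_mem_iff.2 ⟨h1, h2⟩)
    (fun {x y z} h1 h2 => sup_imp x y z ▸ P.inf_mem_iff.2 ⟨h1, h2⟩) hab
  exact hb (h Q hQ ha)

theorem diff_mem_iff {P : PrimeFilter α} {a b : α} :
    diff a b ∈ P ↔ ∃ Q, S P Q ∧ a ∈ Q ∧ b ∉ Q := by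
  refine ⟨fun hab => ?_, fun ⟨Q, hQ, ha, hb⟩ => hQ a b ha hb⟩
  have of_le : ∀ {x y : α}, x ≤ y → diff x y ∉ P := fun {x y} hxy h => by
    have h1 := sup_diff x y y
    rw [sup_eq_right.2 hxy, diff_self, sup_bot_eq] at h1
    exact P.bot_notMem (h1 ▸ h)
  obtain ⟨Q, ha, hb, hQ⟩ := exists_of_rel (rel := fun x y => diff x y ∉ P) of_le
    (fun {x y z} h1 h2 h => (P.sup_mem_iff.1 (P.mem_of_le (diff_trans x y z) h)).elim h1 h2)
    (fun {x y z} h1 h2 h => (P.sup_mem_iff.1 (diff_inf x y z ▸ h)).elim h1 h2)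
    (fun {x y z} h1 h2 h => (P.sup_mem_iff.1 (sup_diff x y z ▸ h)).elim h1 h2) (not_not.2 hab)
  exact ⟨Q, fun x y hx hy => by_contra fun h => hy (hQ x y h hx), ha, hb⟩

theorem box_R_mem {U : Set (PrimeFilter α)} (hU : U ∈ freeBooleanExtension α) :
    {P | ∀ Q, R P Q → Q ∈ U} ∈ freeBooleanExtension α := by
  classical
  obtain ⟨t, ht⟩ := BooleanSubalgebra.compl_mem hU
  have : {P | ∀ Q, R P Q → Q ∈ U} = t.inf fun p => stone (imp p.1 p.2) := by
    ext P
    rw [Finset.inf_eq_iInf]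
    simp only [Set.iInf_eq_iInter, Set.mem_iInter, Set.mem_ofPred_eq, stone, imp_mem_iff]
    have h1 : ∀ Q, Q ∈ U ↔ ∀ p ∈ t, p.1 ∈ Q → p.2 ∈ Q := fun Q => by
      rw [← not_iff_not, ← Set.mem_compl_iff, ht]
      push Not
      simp only [stone, Set.mem_iUnion, Set.mem_sdiff, Set.mem_ofPred_eq, exists_prop]
    simp only [h1]
    exact ⟨fun h p hp Q hQ => h Q hQ p hp, fun h Q hQ p hp => h p hp Q hQ⟩
  rw [this]
  exact t.inf_mem _ BooleanSubalgebra.top_mem (fun _ h _ => BooleanSubalgebra.inf_mem h) _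
    fun p _ => stone_mem _

theorem box_S_mem {U : Set (PrimeFilter α)} (hU : U ∈ freeBooleanExtension α) :
    {P | ∀ Q, S P Q → Q ∈ U} ∈ freeBooleanExtension α := by
  classical
  obtain ⟨t, ht⟩ := BooleanSubalgebra.compl_mem hU
  rw [← BooleanSubalgebra.compl_mem_iff]
  have : {P | ∀ Q, S P Q → Q ∈ U}ᶜ = t.sup fun p => stone (diff p.1 p.2) := by
    ext P
    rw [Finset.sup_eq_iSup]
    simp only [Set.iSup_eq_iUnion, Set.mem_iUnion, Set.mem_compl_iff, Set.mem_ofPred_eq, stone,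
      diff_mem_iff]
    have h1 : ∀ Q, Q ∉ U ↔ ∃ p ∈ t, p.1 ∈ Q ∧ p.2 ∉ Q := fun Q => by
      rw [← Set.mem_compl_iff, ht]
      simp only [stone, Set.mem_iUnion, Set.mem_sdiff, Set.mem_ofPred_eq, exists_prop]
    push Not
    simp only [h1]
    exact ⟨fun ⟨Q, hQ, p, hp, h⟩ => ⟨p, hp, Q, hQ, h⟩, fun ⟨p, hp, Q, hQ, h⟩ => ⟨Q, hQ, p, hp, h⟩⟩
  rw [this]
  exact t.sup_mem _ BooleanSubalgebra.bot_mem (fun _ h _ => BooleanSubalgebra.sup_mem h) _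
    fun p _ => stone_mem _

/-- The free Boolean extension of a WHB-algebra with the operators
`G U = {P | R(P) ⊆ U}` and `H U = {P | S(P) ⊆ U}`. -/
instance : TenseAlgebra (freeBooleanExtension α) where
  G U := ⟨{P | ∀ Q, R P Q → Q ∈ U.1}, box_R_mem U.2⟩
  H U := ⟨{P | ∀ Q, S P Q → Q ∈ U.1}, box_S_mem U.2⟩
  gc_P_G U V := by
    change {P | ∀ Q, S P Q → Q ∈ U.1ᶜ}ᶜ ⊆ V.1 ↔ U.1 ⊆ {P | ∀ Q, R P Q → Q ∈ V.1}
    constructor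
    · exact fun h P hP Q hPQ => h fun hQ => hQ P (S_iff_R.2 hPQ) hP
    · intro h P hP
      by_contra hPV
      exact hP fun Q hQ hQU => hPV (h hQU P (S_iff_R.1 hQ))
  gc_F_H U V := by
    change {P | ∀ Q, R P Q → Q ∈ U.1ᶜ}ᶜ ⊆ V.1 ↔ U.1 ⊆ {P | ∀ Q, S P Q → Q ∈ V.1}
    constructor
    · exact fun h P hP Q hPQ => h fun hQ => hQ P (S_iff_R.1 hPQ) hP
    · intro h P hP
      by_contra hPV
      exact hP fun Q hQ hQU => hPV (h hQU P (S_iff_R.2 hQ))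

end WHB

end PrimeFilter

/-- `T(A)`, the free tense extension of a WHB-algebra `A`. -/
def WHBAlg.T (A : WHBAlg.{u}) : TenseAlg.{u} where
  carrier := PrimeFilter.freeBooleanExtension A

/-- `N` is a tense companion of `K`: `T(K) ⊆ N` and `M(N) ⊆ K`. (Both are taken to be
varieties.) -/
def IsTenseCompanion (N : Set TenseAlg.{u}) (K : Set WHBAlg.{u}) : Prop :=
  WHBAlg.T '' K ⊆ N ∧ TenseAlg.M '' N ⊆ K

/-! ### Congruence extension for tense algebras -/

/-! The CEP concerns one algebra `B` at a time: the congruence sought on `B` is not tied to any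
variety. It holds for every tense algebra and every WHB-algebra, hence for every class of them, and
both sides of the equivalence in (1) are true.

In a tense algebra, congruences correspond to filters closed under `G` and `H`. The `⊤`-class of `δ`
generates such a filter in the large algebra because `G` and `H` preserve meets. Nothing new is
identified in `A`: an equation `a ⊓ c = b ⊓ c` with `a`, `b`, `c` in `A` already holds in `A`.

In a WHB-algebra there is no complement, so filters give way to prime filters. A set of prime
filters closed under `R` and `S` defines a congruence, "belonging to the same members", since
`imp_mem_iff` and `diff_mem_iff` express both operations through `R` and `S`. The set used is that
of prime filters with `δ`-saturated trace. It separates what `δ` separates: a prime filter of `A /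
δ` pulls back to `A` and then lifts to the large algebra. Both existence statements come from
`PrimeFilter.exists_of_rel`. -/

namespace TenseSubalgebra

variable {β : Type u} [TenseAlgebra β] (A : TenseSubalgebra β)

/-- The congruence of a tense algebra generated by a congruence `δ` of a subalgebra: `x` and `y` are
related if they agree below some element of the filter `{c | δ.r c ⊤}`. -/
def extendCongruence (δ : TenseCongruence A) : TenseCongruence β where
  r x y := ∃ c : A, δ.r c ⊤ ∧ x ⊓ c = y ⊓ c
  iseqv.refl x := ⟨⊤, δ.refl ⊤, rfl⟩
  iseqv.symm := fun ⟨c, hc, h⟩ => ⟨c, hc, h.symm⟩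
  iseqv.trans := by
    rintro x y z ⟨c, hc, h⟩ ⟨d, hd, h'⟩
    refine ⟨c ⊓ d, by simpa using δ.inf hc hd, ?_⟩
    change x ⊓ ((c : β) ⊓ d) = z ⊓ ((c : β) ⊓ d)
    rw [← inf_assoc, h, inf_right_comm, h', inf_right_comm, inf_assoc]
  inf := by
    rintro w x y z ⟨c, hc, h⟩ ⟨d, hd, h'⟩
    refine ⟨c ⊓ d, by simpa using δ.inf hc hd, ?_⟩
    change (w ⊓ y) ⊓ ((c : β) ⊓ d) = (x ⊓ z) ⊓ ((c : β) ⊓ d)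
    rw [inf_inf_inf_comm, h, h', inf_inf_inf_comm]
  sup := by
    rintro w x y z ⟨c, hc, h⟩ ⟨d, hd, h'⟩
    refine ⟨c ⊓ d, by simpa using δ.inf hc hd, ?_⟩
    change (w ⊔ y) ⊓ ((c : β) ⊓ d) = (x ⊔ z) ⊓ ((c : β) ⊓ d)
    rw [inf_sup_right, inf_sup_right, ← inf_assoc, h, inf_assoc,
      inf_comm (c : β), ← inf_assoc y, h', inf_assoc z]
  compl := by
    rintro x y ⟨c, hc, h⟩
    -- Below `c`, the complement of `x` depends only on `x ⊓ c`.
    have key : ∀ x : β, xᶜ ⊓ c = (x ⊓ c)ᶜ ⊓ c := fun x => by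
      rw [compl_inf, inf_sup_right, compl_inf_self, sup_bot_eq]
    exact ⟨c, hc, by rw [key x, key y, h]⟩
  G := by
    rintro x y ⟨c, hc, h⟩
    -- `G c` is again in the `⊤`-class because `G ⊤ = ⊤`, and it serves as the new witness because
    -- `G` preserves meets.
    have hG : TenseAlgebra.G (⊤ : A) = ⊤ := TenseAlgebra.gc_P_G.u_top
    exact ⟨TenseAlgebra.G c, hG ▸ δ.G hc, by
      change TenseAlgebra.G x ⊓ TenseAlgebra.G (c : β) = TenseAlgebra.G y ⊓ TenseAlgebra.G (c : β)
      rw [← TenseAlgebra.G_inf, h, TenseAlgebra.G_inf]⟩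
  H := by
    rintro x y ⟨c, hc, h⟩
    have hH : TenseAlgebra.H (⊤ : A) = ⊤ := TenseAlgebra.gc_F_H.u_top
    have hinf : ∀ x y : β, TenseAlgebra.H (x ⊓ y) = TenseAlgebra.H x ⊓ TenseAlgebra.H y :=
      fun _ _ => TenseAlgebra.gc_F_H.u_inf
    exact ⟨TenseAlgebra.H c, hH ▸ δ.H hc, by
      change TenseAlgebra.H x ⊓ TenseAlgebra.H (c : β) = TenseAlgebra.H y ⊓ TenseAlgebra.H (c : β)
      rw [← hinf, h, hinf]⟩

theorem extendCongruence_iff (δ : TenseCongruence A) (a b : A) :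
    δ.r a b ↔ (A.extendCongruence δ).r (a : β) (b : β) := by
  constructor
  · intro h
    -- The biconditional of `a` and `b`: it meets `a` and `b` in the same element, and it collapses
    -- to `⊤` once `δ` identifies them.
    refine ⟨(aᶜ ⊔ b) ⊓ (bᶜ ⊔ a), ?_, ?_⟩
    · have h₁ := δ.sup (δ.compl h) (δ.refl b)
      have h₂ := δ.sup (δ.compl (δ.symm h)) (δ.refl a)
      simpa using δ.inf h₁ h₂
    · have key : ∀ x y : A, x ⊓ ((xᶜ ⊔ y) ⊓ (yᶜ ⊔ x)) = x ⊓ y := fun x y => by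
        rw [← inf_assoc, inf_sup_left x xᶜ y, inf_compl_self, bot_sup_eq, inf_assoc,
          inf_sup_left y yᶜ x, inf_compl_self, bot_sup_eq, inf_comm y x, ← inf_assoc, inf_idem]
      have h' := key b a
      rw [inf_comm (bᶜ ⊔ a), inf_comm b a] at h'
      exact congrArg Subtype.val ((key a b).trans h'.symm)
  · rintro ⟨c, hc, h⟩
    have key : ∀ x : A, δ.r x (x ⊓ c) := fun x => by
      simpa using δ.inf (δ.refl x) (δ.symm hc)
    have h' : a ⊓ c = b ⊓ c := Subtype.ext h
    exact δ.trans (key a) (h' ▸ δ.symm (key b))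

end TenseSubalgebra

theorem tenseHasCEP (N : Set TenseAlg.{u}) : TenseHasCEP N :=
  fun _ _ A δ => ⟨A.extendCongruence δ, A.extendCongruence_iff δ⟩

/-! ### Congruence extension for WHB-algebras -/

namespace WHBSubalgebra

variable {β : Type u} [WHBAlgebra β] (A : WHBSubalgebra β)

/-- Every prime filter of a subalgebra is the trace of a prime filter of the whole algebra. -/
theorem exists_primeFilter_trace (P : PrimeFilter A) :
    ∃ Q : PrimeFilter β, ∀ a : A, (a : β) ∈ Q ↔ a ∈ P := by
  -- The relation is the order of `β` after `P` is forced up to `⊤` and its complement down to `⊥`.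
  -- Primeness of `P` keeps `q ⊔ q'` outside `P`. If `⊤` were related to `⊥`, some `p ∈ P` would lie
  -- below some `q ∉ P`.
  obtain ⟨Q, htop, hbot, hQ⟩ := PrimeFilter.exists_of_rel
    (rel := fun x y : β => ∃ p q : A, p ∈ P ∧ q ∉ P ∧ x ⊓ p ≤ y ⊔ q)
    (fun h => ⟨⊤, ⊥, P.top_mem, P.bot_notMem, inf_le_left.trans (h.trans le_sup_left)⟩)
    (by
      rintro x y z ⟨p, q, hp, hq, h⟩ ⟨p', q', hp', hq', h'⟩
      refine ⟨p ⊓ p', q ⊔ q', P.inf_mem_iff.2 ⟨hp, hp'⟩,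
        fun hn => (P.sup_mem_iff.1 hn).elim hq hq', ?_⟩
      calc x ⊓ ((p : β) ⊓ p') = (x ⊓ p) ⊓ p' := (inf_assoc _ _ _).symm
        _ ≤ (y ⊔ q) ⊓ p' := inf_le_inf_right _ h
        _ = y ⊓ p' ⊔ q ⊓ p' := inf_sup_right _ _ _
        _ ≤ (z ⊔ q') ⊔ q := sup_le_sup h' inf_le_left
        _ = z ⊔ ((q : β) ⊔ q') := by rw [sup_assoc, sup_comm (q' : β)])
    (by
      rintro x y z ⟨p, q, hp, hq, h⟩ ⟨p', q', hp', hq', h'⟩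
      refine ⟨p ⊓ p', q ⊔ q', P.inf_mem_iff.2 ⟨hp, hp'⟩,
        fun hn => (P.sup_mem_iff.1 hn).elim hq hq', ?_⟩
      rw [sup_inf_right]
      exact le_inf
        ((inf_le_inf_left x inf_le_left).trans (h.trans (sup_le_sup_left le_sup_left y)))
        ((inf_le_inf_left x inf_le_right).trans (h'.trans (sup_le_sup_left le_sup_right z))))
    (by
      rintro x y z ⟨p, q, hp, hq, h⟩ ⟨p', q', hp', hq', h'⟩
      refine ⟨p ⊓ p', q ⊔ q', P.inf_mem_iff.2 ⟨hp, hp'⟩,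
        fun hn => (P.sup_mem_iff.1 hn).elim hq hq', ?_⟩
      rw [inf_sup_right]
      exact sup_le
        ((inf_le_inf_left x inf_le_left).trans (h.trans (sup_le_sup_left le_sup_left z)))
        ((inf_le_inf_left y inf_le_right).trans (h'.trans (sup_le_sup_left le_sup_right z))))
    (a := ⊤) (b := ⊥)
    (by
      rintro ⟨p, q, hp, hq, h⟩
      rw [top_inf_eq, bot_sup_eq] at h
      exact hq (P.mem_of_le (show p ≤ q from h) hp))
  refine ⟨Q, fun a => ⟨fun ha => ?_, fun ha => ?_⟩⟩
  · by_contra hn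
    exact hbot (hQ a ⊥ ⟨⊤, a, P.top_mem, hn, inf_le_left.trans le_sup_right⟩ ha)
  · exact hQ ⊤ a ⟨a, ⊥, ha, P.bot_notMem, inf_le_right.trans le_sup_left⟩ htop

/-- The prime filters whose trace on the subalgebra `A` is a union of classes of `δ`. -/
def saturatedPrimeFilters (δ : WHBCongruence A) : Set (PrimeFilter β) :=
  {Q | ∀ a b : A, δ.r a b → (a : β) ∈ Q → (b : β) ∈ Q}

variable {A} {δ : WHBCongruence A}

/-- If `δ` identifies `a` and `b`, it identifies `a → b` with `a → a = ⊤`, so saturation puts `a →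
b` in `P`, and `R` carries `a` to `b`. -/
theorem saturated_of_R {P Q : PrimeFilter β} (hP : P ∈ A.saturatedPrimeFilters δ)
    (h : PrimeFilter.R P Q) : Q ∈ A.saturatedPrimeFilters δ := by
  intro a b hab ha
  have h₁ := δ.imp (δ.refl a) hab
  rw [WHBAlgebra.imp_self] at h₁
  exact h a b (hP _ _ h₁ P.top_mem) ha

/-- Dually, `a ← b` is identified with `b ← b = ⊥`, so it cannot lie in `P`. -/
theorem saturated_of_S {P Q : PrimeFilter β} (hP : P ∈ A.saturatedPrimeFilters δ)
    (h : PrimeFilter.S P Q) : Q ∈ A.saturatedPrimeFilters δ := by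
  intro a b hab ha
  by_contra hb
  have h₁ := δ.diff hab (δ.refl b)
  rw [WHBAlgebra.diff_self] at h₁
  exact P.bot_notMem (hP _ _ h₁ (h a b ha hb))

variable (A) in
/-- The extension to the whole algebra of a congruence `δ` of a subalgebra: two elements are
related if they belong to the same prime filters with `δ`-saturated trace. -/
def extendCongruence (δ : WHBCongruence A) : WHBCongruence β where
  r x y := ∀ Q ∈ A.saturatedPrimeFilters δ, x ∈ Q ↔ y ∈ Q
  iseqv.refl _ _ _ := Iff.rfl
  iseqv.symm h Q hQ := (h Q hQ).symm
  iseqv.trans h h' Q hQ := (h Q hQ).trans (h' Q hQ)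
  inf h h' Q hQ := by rw [Q.inf_mem_iff, Q.inf_mem_iff, h Q hQ, h' Q hQ]
  sup h h' Q hQ := by rw [Q.sup_mem_iff, Q.sup_mem_iff, h Q hQ, h' Q hQ]
  imp h h' P hP := by
    rw [PrimeFilter.imp_mem_iff, PrimeFilter.imp_mem_iff]
    -- Only the `R`-successors of `P` matter, and these are saturated too.
    refine forall_congr' fun Q => forall_congr' fun hPQ => ?_
    have hQ := saturated_of_R hP hPQ
    rw [h Q hQ, h' Q hQ]
  diff h h' P hP := by
    rw [PrimeFilter.diff_mem_iff, PrimeFilter.diff_mem_iff]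
    refine exists_congr fun Q => and_congr_right fun hPQ => ?_
    have hQ := saturated_of_S hP hPQ
    rw [h Q hQ, h' Q hQ]

/-- The relation `δ.r (x ⊓ y) x` is the order of the quotient by `δ`, read on representatives. A
prime filter closed under it is saturated, and any lift to `β` keeps that trace. -/
theorem exists_saturated_separating {a b : A} (hab : ¬ δ.r (a ⊓ b) a) :
    ∃ Q ∈ A.saturatedPrimeFilters δ, (a : β) ∈ Q ∧ (b : β) ∉ Q := by
  obtain ⟨P, ha, hb, hP⟩ := PrimeFilter.exists_of_rel (rel := fun x y : A => δ.r (x ⊓ y) x)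
    (fun {x y} h => by rw [inf_eq_left.2 h])
    (fun {x y z} h h' => by
      have h₁ := δ.inf (δ.refl x) h'
      have h₂ := δ.inf h (δ.refl z)
      rw [← inf_assoc] at h₁
      exact δ.trans (δ.symm h₂) (δ.trans h₁ h))
    (fun {x y z} h h' => by
      have h₁ := δ.inf h h'
      rwa [← inf_inf_distrib_left, inf_idem] at h₁)
    (fun {x y z} h h' => by
      have h₁ := δ.sup h h'
      rwa [← inf_sup_right] at h₁) hab
  obtain ⟨Q, hQ⟩ := A.exists_primeFilter_trace P
  refine ⟨Q, fun x y hxy hx => (hQ y).2 (hP x y ?_ ((hQ x).1 hx)), (hQ a).2 ha,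
    fun h => hb ((hQ b).1 h)⟩
  have h₁ := δ.inf (δ.refl x) (δ.symm hxy)
  rwa [inf_idem] at h₁

theorem extendCongruence_iff (δ : WHBCongruence A) (a b : A) :
    δ.r a b ↔ (A.extendCongruence δ).r (a : β) (b : β) := by
  refine ⟨fun h Q hQ => ⟨hQ a b h, hQ b a (δ.symm h)⟩, fun h => ?_⟩
  -- Equality modulo `δ` is split into two inequalities in the quotient.
  have key : ∀ x y : A, (A.extendCongruence δ).r (x : β) (y : β) → δ.r (x ⊓ y) x := by
    intro x y hxy
    by_contra hn
    obtain ⟨Q, hQ, hx, hy⟩ := exists_saturated_separating hn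
    exact hy ((hxy Q hQ).1 hx)
  have h₁ := key b a ((A.extendCongruence δ).symm h)
  rw [inf_comm] at h₁
  exact δ.trans (δ.symm (key a b h)) h₁

end WHBSubalgebra

theorem whbHasCEP (K : Set WHBAlg.{u}) : WHBHasCEP K :=
  fun _ _ A δ => ⟨A.extendCongruence δ, WHBSubalgebra.extendCongruence_iff δ⟩

theorem mainTheorem10 :
    (∀ (K : Set WHBAlg.{u}) (N : Set TenseAlg.{u}), IsWHBVariety K → IsTenseVariety N →
      IsTenseCompanion N K → (WHBHasCEP K ↔ TenseHasCEP N)) ∧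
    TenseHasCEP (Set.univ : Set TenseAlg.{u}) ∧
    WHBHasCEP (Set.univ : Set WHBAlg.{u}) ∧
    (∀ K : Set WHBAlg.{u}, IsWHBVariety K → WHBHasCEP K) :=
  ⟨fun K N _ _ _ => iff_of_true (whbHasCEP K) (tenseHasCEP N), tenseHasCEP _, whbHasCEP _,
    fun K _ => whbHasCEP K⟩
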